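/- Let $r\ge 0$ be an integer and let $Q,P_1,P_2$ be polynomials with complex coefficients such that $\deg P_1=r$, $\deg P_2\le r$ and $\deg Q\le r$ (with $\deg 0=-\infty$). Suppose that the common real zeros of $P_1$ and $P_2$, if there are any, are zeros of $Q$, counted with multiplicity: whenever $a\in\mathbb R$, $n\ge 1$ and $(x-a)^n$ divides both $P_1$ and $P_2$, it also divides $Q$. For $P(x)=\sum_k a_kx^k$ put $P(-i\frac{d}{dx})f=\sum_k a_k(-i)^kf^{(k)}$, and let $\|\cdot\|_p$ be the norm of $L_p(\mathbb R)$, with value $+\infty$ for functions outside $L_p(\mathbb R)$. Let $1\le q\le\infty$. Consider the inequality $$\Big\|Q\big(-i\tfrac{d}{dx}\big)f\Big\|_q\le c\,\Big(\Big\|P_1\big(-i\tfrac{d}{dx}\big)f\Big\|_{p_1}+\Big\|P_2\big(-i\tfrac{d}{dx}\big)f\Big\|_{p_2}\Big)\qquad(*)$$ for all $f:\mathbb R\to\mathbb C$ such that $f\in L_1(\mathbb R)$ and $f^{(r)}\in L_1(\mathbb R)$, where, if $r\ge1$, $f$ is $r-1$ times continuously differentiable and $f^{(r-1)}$ is locally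 absolutely continuous. 1. If $\deg Q=r$, then for $p_1=q$ and every $p_2\in[1,q]$ there is a finite constant $c$, independent of $f$, such that $(*)$ holds for all such $f$. 2. If $\deg Q<r$, then for all $p_1\in[1,q]$ and $p_2\in[1,q]$ there is a finite constant $c$, independent of $f$, such that $(*)$ holds for all such $f$. -/

import Mathlib

open Polynomial MeasureTheory
open scoped NNReal ENNReal

/-- The differential operator `P(-i d/dx)` on the line: for `P = ∑ₖ aₖ Xᵏ`,
`P(-i d/dx) f (x) = ∑ₖ aₖ (-i)ᵏ f⁽ᵏ⁾(x)`. -/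
noncomputable def diffOp (P : ℂ[X]) (f : ℝ → ℂ) (x : ℝ) : ℂ :=
  P.sum fun k a => a * (-Complex.I) ^ k * iteratedDeriv k f x

/-- `f` and `f⁽ʳ⁾` belong to `L₁(ℝ)`, where (if `r ≥ 1`) `f` is `r - 1` times continuously
differentiable and `f⁽ʳ⁻¹⁾` is locally absolutely continuous. -/
structure IsAdmissible (r : ℕ) (f : ℝ → ℂ) : Prop where
  contDiff : ∀ m : ℕ, r = m + 1 → ContDiff ℝ m f
  absolutelyContinuous : ∀ m : ℕ, r = m + 1 →
    ∀ a b : ℝ, AbsolutelyContinuousOnInterval (iteratedDeriv m f) a b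
  integrable : Integrable f
  integrable_iteratedDeriv : Integrable (iteratedDeriv r f)

/-- Every common real zero of `P₁` and `P₂` is a zero of `Q`, counted with multiplicity: a factor
`(x - a)ⁿ`, with `a` real, that divides both `P₁` and `P₂` also divides `Q`. (The zero polynomial
is divisible by all of them.) -/
def CommonRealZerosAreZeros (P₁ P₂ Q : ℂ[X]) : Prop :=
  ∀ (a : ℝ) (n : ℕ), (X - C (a : ℂ)) ^ n ∣ P₁ → (X - C (a : ℂ)) ^ n ∣ P₂ →
    (X - C (a : ℂ)) ^ n ∣ Q

/-! On the Fourier side `P(-i d/dx)` is multiplication by `P(2πξ)`. Suppose `deg Q < r`. Cancelling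
the common real zeros gives `P₁ = G p₁`, `P₂ = G p₂`, `Q = G q`, and `R = |p₁|² + |p₂|²` has no zero
on the real line. With `A_j = q · conj p_j` this yields `Q = (A₁/R) P₁ + (A₂/R) P₂`, whose
coefficients are strictly proper and have no real poles (`CommonRealZerosAreZeros.exists_bezout`).

Such fractions are built from the symbols `1/(x - l)` with `l` non-real, which are transforms of
one-sided decaying exponentials. These kernels are bounded and integrable, so Young's inequality
maps `Lᵖ` to `L^q` for all `1 ≤ p ≤ q` (`isBddMultiplier_div`). Injectivity of the Fourier transform
on `L¹` turns the identity of symbols into one of functions; it applies because all derivatives up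
to order `r` are integrable (`integrable_iteratedDeriv_of_succ`).

If `deg Q = r`, subtracting a multiple of `P₁` lowers the degree; the subtracted term is controlled
by its own `L^q` norm, hence `p₁ = q`. -/

open scoped FourierTransform Convolution
open Filter Set

/-! ### Algebra: common real zeros and a Bézout identity -/

lemma CommonRealZerosAreZeros.of_mul {b : ℝ} {P₁ P₂ Q : ℂ[X]}
    (h : CommonRealZerosAreZeros ((X - C (b : ℂ)) * P₁) ((X - C (b : ℂ)) * P₂)
      ((X - C (b : ℂ)) * Q)) : CommonRealZerosAreZeros P₁ P₂ Q := by
  intro a n h₁ h₂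
  by_cases hab : a = b
  · subst hab
    have := h a (n + 1) (by rw [pow_succ']; exact mul_dvd_mul_left _ h₁)
      (by rw [pow_succ']; exact mul_dvd_mul_left _ h₂)
    rw [pow_succ'] at this
    exact (mul_dvd_mul_iff_left (X_sub_C_ne_zero _)).1 this
  · have := h a n (h₁.mul_left _) (h₂.mul_left _)
    refine IsCoprime.dvd_of_dvd_mul_left (IsCoprime.pow_left ?_) this
    exact isCoprime_X_sub_C_of_isUnit_sub
      (sub_ne_zero.2 fun e => hab (by exact_mod_cast e)).isUnit

/-- The common real zeros of `P₁` and `P₂` can be cancelled from `P₁`, `P₂` and `Q`. -/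
lemma CommonRealZerosAreZeros.exists_eq_mul {P₁ P₂ Q : ℂ[X]} (hP₁ : P₁ ≠ 0)
    (h : CommonRealZerosAreZeros P₁ P₂ Q) :
    ∃ G p₁ p₂ q : ℂ[X], P₁ = G * p₁ ∧ P₂ = G * p₂ ∧ Q = G * q ∧
      ∀ a : ℝ, p₁.eval (a : ℂ) = 0 → p₂.eval (a : ℂ) ≠ 0 := by
  induction hn : P₁.natDegree using Nat.strong_induction_on generalizing P₁ P₂ Q with
  | _ n ih =>
    by_cases hz : ∀ a : ℝ, P₁.eval (a : ℂ) = 0 → P₂.eval (a : ℂ) ≠ 0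
    · exact ⟨1, P₁, P₂, Q, by simp, by simp, by simp, hz⟩
    push Not at hz
    obtain ⟨a, h₁, h₂⟩ := hz
    have d₁ := dvd_iff_isRoot.2 h₁
    have d₂ := dvd_iff_isRoot.2 h₂
    have d : X - C (a : ℂ) ∣ Q := by simpa using h a 1 (by simpa using d₁) (by simpa using d₂)
    obtain ⟨P₁, rfl⟩ := d₁
    obtain ⟨P₂, rfl⟩ := d₂
    obtain ⟨Q, rfl⟩ := d
    have hP₁' : P₁ ≠ 0 := right_ne_zero_of_mul hP₁
    have hdeg : P₁.natDegree < n := by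
      rw [← hn, natDegree_mul (X_sub_C_ne_zero _) hP₁', natDegree_X_sub_C]
      omega
    obtain ⟨G, p₁, p₂, q, rfl, rfl, rfl, hp⟩ := ih _ hdeg hP₁' h.of_mul rfl
    exact ⟨(X - C (a : ℂ)) * G, p₁, p₂, q, by ring, by ring, by ring, hp⟩

lemma eval_mul_map_conj (p : ℂ[X]) (x : ℝ) :
    (p * p.map (starRingEnd ℂ)).eval (x : ℂ) = (‖p.eval (x : ℂ)‖ ^ 2 : ℝ) := by
  have : (p.map (starRingEnd ℂ)).eval (x : ℂ) = starRingEnd ℂ (p.eval (x : ℂ)) := by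
    conv_lhs => rw [← Complex.conj_ofReal x]
    exact eval_map_apply _ _
  rw [eval_mul, this, Complex.mul_conj']
  norm_cast

lemma coeff_mul_map_conj {p : ℂ[X]} {n : ℕ} (hp : p.natDegree ≤ n) :
    (p * p.map (starRingEnd ℂ)).coeff (n + n) = (‖p.coeff n‖ ^ 2 : ℝ) := by
  rw [coeff_mul_add_eq_of_natDegree_le hp (natDegree_map_le.trans hp), coeff_map,
    Complex.mul_conj']
  norm_cast

/-- A Bézout identity whose coefficients `A₁ / R` and `A₂ / R` are strictly proper rational
functions without real poles. -/
lemma CommonRealZerosAreZeros.exists_bezout {P₁ P₂ Q : ℂ[X]} (hP₁ : P₁ ≠ 0)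
    (hP₂ : P₂.degree ≤ P₁.degree) (hQ : Q.degree < P₁.degree)
    (h : CommonRealZerosAreZeros P₁ P₂ Q) :
    ∃ R A₁ A₂ : ℂ[X], (∀ x : ℝ, R.eval (x : ℂ) ≠ 0) ∧ A₁.degree < R.degree ∧
      A₂.degree < R.degree ∧ Q * R = A₁ * P₁ + A₂ * P₂ := by
  obtain ⟨G, p₁, p₂, q, rfl, rfl, rfl, hp⟩ := h.exists_eq_mul hP₁
  have hG : G ≠ 0 := left_ne_zero_of_mul hP₁
  have hp₁ : p₁ ≠ 0 := right_ne_zero_of_mul hP₁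
  have hGd : G.degree ≠ ⊥ := degree_eq_bot.not.2 hG
  rw [degree_mul, degree_mul] at hP₂ hQ
  replace hP₂ : p₂.degree ≤ p₁.degree := (WithBot.add_le_add_iff_left hGd).1 hP₂
  replace hQ : q.degree < p₁.degree := (WithBot.add_lt_add_iff_left hGd).1 hQ
  set s := p₁.natDegree with hs
  have hp₂n : p₂.natDegree ≤ s := natDegree_le_natDegree hP₂
  -- On the real line `R = |p₁|² + |p₂|²`. Its coefficient of degree `2s` is also a sum of squared
  -- moduli, so no cancellation occurs there.
  set R := p₁ * p₁.map (starRingEnd ℂ) + p₂ * p₂.map (starRingEnd ℂ) with hR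
  have hRc : R.coeff (s + s) ≠ 0 := by
    rw [hR, coeff_add, coeff_mul_map_conj le_rfl, coeff_mul_map_conj hp₂n]
    have : (0 : ℝ) < ‖p₁.coeff s‖ ^ 2 := by
      have : p₁.coeff s ≠ 0 := by rw [hs]; exact leadingCoeff_ne_zero.2 hp₁
      positivity
    rw [← Complex.ofReal_add]
    exact_mod_cast (add_pos_of_pos_of_nonneg this (by positivity)).ne'
  have hRd : ((s + s : ℕ) : WithBot ℕ) ≤ R.degree := le_degree_of_ne_zero hRc
  have hconj : ∀ p : ℂ[X], p.degree ≤ p₁.degree →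
      (q * p.map (starRingEnd ℂ)).degree < R.degree := by
    intro p hpd
    refine lt_of_lt_of_le ?_ hRd
    rw [degree_mul, degree_map, Nat.cast_add, hs, ← degree_eq_natDegree hp₁]
    refine (add_le_add_right hpd _).trans_lt ?_
    exact (WithBot.add_lt_add_iff_right (degree_eq_bot.not.2 hp₁)).2 hQ
  refine ⟨R, q * p₁.map (starRingEnd ℂ), q * p₂.map (starRingEnd ℂ), ?_, hconj _ le_rfl,
    hconj _ hP₂, by rw [hR]; ring⟩
  intro x
  rw [hR, eval_add, eval_mul_map_conj, eval_mul_map_conj, ← Complex.ofReal_add]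
  by_cases h0 : p₁.eval (x : ℂ) = 0
  · have := norm_pos_iff.2 (hp x h0)
    exact_mod_cast (by positivity : (0:ℝ) < ‖p₁.eval (x : ℂ)‖ ^ 2 + ‖p₂.eval (x : ℂ)‖ ^ 2).ne'
  · have := norm_pos_iff.2 h0
    exact_mod_cast (by positivity : (0:ℝ) < ‖p₁.eval (x : ℂ)‖ ^ 2 + ‖p₂.eval (x : ℂ)‖ ^ 2).ne'

/-! ### Young's inequality -/

/-- Interpolation between `Lᵖ` and `L^∞`. -/
lemma eLpNorm_le_of_le_of_le {α E : Type*} [MeasurableSpace α] {μ : Measure α}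
    [NormedAddCommGroup E] {h : α → E} {p q S : ℝ≥0∞} (hp0 : p ≠ 0)
    (hpq : p ≤ q) (hp : eLpNorm h p μ ≤ S) (htop : eLpNorm h ∞ μ ≤ S) : eLpNorm h q μ ≤ S := by
  rcases eq_or_ne q ∞ with rfl | hqt
  · exact htop
  have hpt : p ≠ ∞ := ne_top_of_le_ne_top hqt hpq
  have hq0 : q ≠ 0 := (lt_of_lt_of_le (pos_iff_ne_zero.2 hp0) hpq).ne'
  have hp' := ENNReal.toReal_pos hp0 hpt
  have hq' := ENNReal.toReal_pos hq0 hqt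
  have hle : p.toReal ≤ q.toReal := ENNReal.toReal_mono hqt hpq
  rw [eLpNorm_eq_lintegral_rpow_enorm_toReal hp0 hpt, one_div, ENNReal.rpow_inv_le_iff hp'] at hp
  rw [eLpNorm_eq_lintegral_rpow_enorm_toReal hq0 hqt, one_div, ENNReal.rpow_inv_le_iff hq']
  rcases eq_or_ne S ∞ with rfl | hS
  · simp [hq']
  rw [eLpNorm_exponent_top] at htop
  have hsplit : ∀ a : ℝ≥0∞, a ^ q.toReal = a ^ (q.toReal - p.toReal) * a ^ p.toReal := fun a => by
    rw [← ENNReal.rpow_add_of_nonneg _ _ (sub_nonneg.2 hle) hp'.le, sub_add_cancel]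
  calc ∫⁻ x, ‖h x‖ₑ ^ q.toReal ∂μ
      ≤ ∫⁻ x, S ^ (q.toReal - p.toReal) * ‖h x‖ₑ ^ p.toReal ∂μ := by
        apply lintegral_mono_ae
        filter_upwards [enorm_ae_le_eLpNormEssSup h μ] with x hx
        rw [hsplit]
        gcongr
        exact hx.trans htop
    _ = S ^ (q.toReal - p.toReal) * ∫⁻ x, ‖h x‖ₑ ^ p.toReal ∂μ :=
        lintegral_const_mul' _ _ (ENNReal.rpow_ne_top_of_nonneg (sub_nonneg.2 hle) hS)
    _ ≤ S ^ (q.toReal - p.toReal) * S ^ p.toReal := by gcongr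
    _ = S ^ q.toReal := (hsplit S).symm

lemma enorm_mul_convolution_le (K g : ℝ → ℂ) (x : ℝ) :
    ‖(K ⋆[ContinuousLinearMap.mul ℂ ℂ, volume] g) x‖ₑ ≤ ∫⁻ t, ‖K t‖ₑ * ‖g (x - t)‖ₑ := by
  rw [convolution_def]
  refine (enorm_integral_le_lintegral_enorm _).trans (le_of_eq ?_)
  simp [enorm_mul]

/-- Young's inequality for a bounded integrable kernel. -/
lemma eLpNorm_mul_convolution_le {K g : ℝ → ℂ} (hK : Integrable K) (hK1 : ∀ x, ‖K x‖ ≤ 1)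
    (hg : AEStronglyMeasurable g) {p q : ℝ≥0∞} (hp : 1 ≤ p) (hpq : p ≤ q) :
    eLpNorm (K ⋆[ContinuousLinearMap.mul ℂ ℂ, volume] g) q volume ≤
      max 1 (∫⁻ t, ‖K t‖ₑ) * eLpNorm g p volume := by
  -- Taking `A ≥ 1` lets one constant serve both endpoints, `q = p` and `q = ∞`.
  set A := max 1 (∫⁻ t, ‖K t‖ₑ) with hA
  have hA1 : 1 ≤ A := le_max_left _ _
  have hKA : ∫⁻ t, ‖K t‖ₑ ≤ A := le_max_right _ _
  have hK1' : ∀ x, ‖K x‖ₑ ≤ 1 := fun x => by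
    rw [← ofReal_norm]
    exact ENNReal.ofReal_le_one.2 (hK1 x)
  have hgx : ∀ x : ℝ, AEStronglyMeasurable (fun t => g (x - t)) volume := fun x =>
    hg.comp_quasiMeasurePreserving (quasiMeasurePreserving_sub_left_of_right_invariant volume x)
  have hp0 : p ≠ 0 := (zero_lt_one.trans_le hp).ne'
  rcases eq_or_ne p ∞ with rfl | hpt
  · obtain rfl : q = ∞ := top_le_iff.1 hpq
    rw [eLpNorm_exponent_top, eLpNorm_exponent_top]
    refine eLpNormEssSup_le_of_ae_enorm_bound (ae_of_all _ fun x => ?_)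
    refine (enorm_mul_convolution_le K g x).trans ?_
    calc ∫⁻ t, ‖K t‖ₑ * ‖g (x - t)‖ₑ ≤ ∫⁻ t, ‖K t‖ₑ * eLpNormEssSup g volume := by
          apply lintegral_mono_ae
          filter_upwards [(quasiMeasurePreserving_sub_left_of_right_invariant volume x).ae
            (enorm_ae_le_eLpNormEssSup g volume)] with t ht
          gcongr
      _ = (∫⁻ t, ‖K t‖ₑ) * eLpNormEssSup g volume := lintegral_mul_const'' _ hK.1.enorm
      _ ≤ _ := by gcongr
  set s := p.toReal with hs
  have hs0 : 0 < s := ENNReal.toReal_pos hp0 hpt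
  have hs1 : 1 ≤ s := by
    simpa using ENNReal.toReal_mono hpt hp
  have hinv : s⁻¹ ≤ 1 := inv_le_one_of_one_le₀ hs1
  set G := ∫⁻ t, ‖g t‖ₑ ^ s with hG
  have hGp : eLpNorm g p volume = G ^ s⁻¹ := by
    rw [eLpNorm_eq_lintegral_rpow_enorm_toReal hp0 hpt, one_div]
  -- Hölder after splitting `|K| = |K|^(1 - 1/s) |K|^(1/s)`.
  have hholder : ∀ x, ‖(K ⋆[ContinuousLinearMap.mul ℂ ℂ, volume] g) x‖ₑ ≤
      A ^ (1 - s⁻¹) * (∫⁻ t, ‖K t‖ₑ * ‖g (x - t)‖ₑ ^ s) ^ s⁻¹ := by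
    intro x
    refine (enorm_mul_convolution_le K g x).trans ?_
    have := ENNReal.lintegral_mul_norm_pow_le (μ := volume) hK.1.enorm
      (hK.1.enorm.mul ((hgx x).enorm.pow_const s)) (sub_nonneg.2 hinv)
      (inv_nonneg.2 hs0.le) (by ring)
    calc ∫⁻ t, ‖K t‖ₑ * ‖g (x - t)‖ₑ
        = ∫⁻ t, ‖K t‖ₑ ^ (1 - s⁻¹) * (‖K t‖ₑ * ‖g (x - t)‖ₑ ^ s) ^ s⁻¹ := by
          refine lintegral_congr fun t => ?_
          rw [ENNReal.mul_rpow_of_nonneg _ _ (inv_nonneg.2 hs0.le), ENNReal.rpow_rpow_inv hs0.ne',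
            ← mul_assoc, ← ENNReal.rpow_add_of_nonneg _ _ (sub_nonneg.2 hinv)
              (inv_nonneg.2 hs0.le), sub_add_cancel, ENNReal.rpow_one]
      _ ≤ _ := this
      _ ≤ _ := by
        gcongr
        rfl
  refine eLpNorm_le_of_le_of_le hp0 hpq ?_ ?_
  -- Endpoint `q = p`: integrate the Hölder bound by Tonelli.
  · rw [hGp, eLpNorm_eq_lintegral_rpow_enorm_toReal hp0 hpt, one_div, ENNReal.rpow_inv_le_iff hs0,
      ENNReal.mul_rpow_of_nonneg _ _ hs0.le, ENNReal.rpow_inv_rpow hs0.ne']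
    have hmeas : AEMeasurable (Function.uncurry fun x t : ℝ => ‖K t‖ₑ * ‖g (x - t)‖ₑ ^ s)
        (volume.prod volume) := by
      refine AEMeasurable.mul (hK.1.comp_snd).enorm (AEMeasurable.pow_const ?_ s)
      exact (hg.comp_quasiMeasurePreserving
        (quasiMeasurePreserving_sub_of_right_invariant volume volume)).enorm
    calc ∫⁻ x, ‖(K ⋆[ContinuousLinearMap.mul ℂ ℂ, volume] g) x‖ₑ ^ s
        ≤ ∫⁻ x, (A ^ (1 - s⁻¹)) ^ s * ∫⁻ t, ‖K t‖ₑ * ‖g (x - t)‖ₑ ^ s := by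
          refine lintegral_mono fun x => ?_
          refine (ENNReal.rpow_le_rpow (hholder x) hs0.le).trans (le_of_eq ?_)
          rw [ENNReal.mul_rpow_of_nonneg _ _ hs0.le, ENNReal.rpow_inv_rpow hs0.ne']
      _ = (A ^ (1 - s⁻¹)) ^ s * ∫⁻ x, ∫⁻ t, ‖K t‖ₑ * ‖g (x - t)‖ₑ ^ s := by
          refine lintegral_const_mul'' _ ?_
          exact hmeas.lintegral_prod_right'
      _ = (A ^ (1 - s⁻¹)) ^ s * ((∫⁻ t, ‖K t‖ₑ) * G) := by
          rw [lintegral_lintegral_swap hmeas]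
          congr 1
          rw [← lintegral_mul_const'' _ hK.1.enorm]
          refine lintegral_congr fun t => ?_
          rw [lintegral_const_mul' _ _ (by finiteness),
            lintegral_sub_right_eq_self (fun x => ‖g x‖ₑ ^ s) t]
      _ ≤ (A ^ (1 - s⁻¹)) ^ s * (A * G) := by gcongr
      _ = A ^ s * G := by
          rw [← ENNReal.rpow_mul, ← mul_assoc]
          congr 1
          nth_rewrite 2 [← ENNReal.rpow_one A]
          rw [← ENNReal.rpow_add_of_nonneg _ _ (mul_nonneg (sub_nonneg.2 hinv) hs0.le) zero_le_one]
          congr 1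
          field_simp
          ring
  -- Endpoint `q = ∞`: drop the remaining factor `|K| ≤ 1`.
  · rw [hGp, eLpNorm_exponent_top]
    refine eLpNormEssSup_le_of_ae_enorm_bound (ae_of_all _ fun x => (hholder x).trans ?_)
    gcongr
    · calc A ^ (1 - s⁻¹) ≤ A ^ (1 : ℝ) :=
            ENNReal.rpow_le_rpow_of_exponent_le hA1 (by linarith [inv_nonneg.2 hs0.le])
        _ = A := ENNReal.rpow_one A
    · calc ∫⁻ t, ‖K t‖ₑ * ‖g (x - t)‖ₑ ^ s ≤ ∫⁻ t, ‖g (x - t)‖ₑ ^ s := by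
            refine lintegral_mono fun t => ?_
            exact mul_le_of_le_one_left' (hK1' t)
        _ = G := lintegral_sub_left_eq_self (fun t => ‖g t‖ₑ ^ s) x

/-! ### Bounded multipliers and rational symbols -/

/-- `m` is the symbol of an operator on `L¹` that is bounded from `Lᵖ` to `L^q` whenever
`1 ≤ p ≤ q`. -/
def IsBddMultiplier (m : ℝ → ℂ) : Prop :=
  ∀ p q : ℝ≥0∞, 1 ≤ p → p ≤ q → ∃ C : ℝ≥0, ∀ g : ℝ → ℂ, Integrable g →
    ∃ h : ℝ → ℂ, Integrable h ∧ (∀ ξ, 𝓕 h ξ = m ξ * 𝓕 g ξ) ∧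
      eLpNorm h q volume ≤ C * eLpNorm g p volume

lemma fourier_add_apply {f g : ℝ → ℂ} (hf : Integrable f) (hg : Integrable g) (ξ : ℝ) :
    𝓕 (f + g) ξ = 𝓕 f ξ + 𝓕 g ξ :=
  congrFun (VectorFourier.fourierIntegral_add Real.continuous_fourierChar continuous_inner hf hg) ξ

lemma fourier_const_smul_apply (c : ℂ) (f : ℝ → ℂ) (ξ : ℝ) :
    𝓕 (c • f) ξ = c * 𝓕 f ξ :=
  congrFun (VectorFourier.fourierIntegral_const_smul Real.fourierChar volume (innerₗ ℝ) f c) ξ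

lemma isBddMultiplier_zero : IsBddMultiplier fun _ => 0 := fun p q _ _ =>
  ⟨0, fun g _ => ⟨0, integrable_zero _ _ _, fun ξ => by
    simpa using fourier_const_smul_apply 0 0 ξ, by simp⟩⟩

lemma IsBddMultiplier.add {m₁ m₂ : ℝ → ℂ} (h₁ : IsBddMultiplier m₁) (h₂ : IsBddMultiplier m₂) :
    IsBddMultiplier fun ξ => m₁ ξ + m₂ ξ := by
  intro p q hp hpq
  obtain ⟨C₁, h₁⟩ := h₁ p q hp hpq
  obtain ⟨C₂, h₂⟩ := h₂ p q hp hpq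
  refine ⟨C₁ + C₂, fun g hg => ?_⟩
  obtain ⟨u, hu, hu', hu''⟩ := h₁ g hg
  obtain ⟨v, hv, hv', hv''⟩ := h₂ g hg
  refine ⟨u + v, hu.add hv, fun ξ => by rw [fourier_add_apply hu hv, hu', hv', add_mul], ?_⟩
  refine (eLpNorm_add_le hu.1 hv.1 (hp.trans hpq)).trans ?_
  rw [ENNReal.coe_add, add_mul]
  exact add_le_add hu'' hv''

lemma IsBddMultiplier.const_mul {m : ℝ → ℂ} (h : IsBddMultiplier m) (c : ℂ) :
    IsBddMultiplier fun ξ => c * m ξ := by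
  intro p q hp hpq
  obtain ⟨C, h⟩ := h p q hp hpq
  refine ⟨‖c‖₊ * C, fun g hg => ?_⟩
  obtain ⟨u, hu, hu', hu''⟩ := h g hg
  refine ⟨c • u, hu.smul c, fun ξ => by rw [fourier_const_smul_apply, hu', mul_assoc], ?_⟩
  rw [eLpNorm_const_smul, ENNReal.coe_mul, mul_assoc]
  exact mul_le_mul_right hu'' _

lemma IsBddMultiplier.mul {m₁ m₂ : ℝ → ℂ} (h₁ : IsBddMultiplier m₁) (h₂ : IsBddMultiplier m₂) :
    IsBddMultiplier fun ξ => m₁ ξ * m₂ ξ := by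
  intro p q hp hpq
  obtain ⟨C₁, h₁⟩ := h₁ p q hp hpq
  obtain ⟨C₂, h₂⟩ := h₂ p p hp le_rfl
  refine ⟨C₁ * C₂, fun g hg => ?_⟩
  obtain ⟨u, hu, hu', hu''⟩ := h₂ g hg
  obtain ⟨v, hv, hv', hv''⟩ := h₁ u hu
  refine ⟨v, hv, fun ξ => by rw [hv', hu', mul_assoc], hv''.trans ?_⟩
  rw [ENNReal.coe_mul, mul_assoc]
  exact mul_le_mul_right hu'' _

lemma isBddMultiplier_fourier {K : ℝ → ℂ} (hK : Integrable K) (hK1 : ∀ x, ‖K x‖ ≤ 1) :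
    IsBddMultiplier (𝓕 K) := by
  intro p q hp hpq
  have hfin : max 1 (∫⁻ t, ‖K t‖ₑ) ≠ ∞ := (max_lt ENNReal.one_lt_top hK.2).ne
  refine ⟨(max 1 (∫⁻ t, ‖K t‖ₑ)).toNNReal, fun g hg =>
    ⟨K ⋆[ContinuousLinearMap.mul ℂ ℂ, volume] g, hK.integrable_convolution _ hg,
      Real.fourier_mul_convolution_eq hK hg, ?_⟩⟩
  rw [ENNReal.coe_toNNReal hfin]
  exact eLpNorm_mul_convolution_le hK hK1 hg.1 hp hpq

/-- The kernel is, up to a factor `±i`, `exp(ilx)` cut off to the half-line on which it decays: the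
negative one if `Im l < 0`, the positive one if `Im l > 0`. -/
lemma isBddMultiplier_inv_sub {l : ℂ} (hl : l.im ≠ 0) :
    IsBddMultiplier fun ξ => ((2 * Real.pi * ξ : ℝ) - l)⁻¹ := by
  have key : ∀ (s : Set ℝ) (x : ℝ) (ξ : ℝ), Real.fourierChar (-(x * ξ)) •
      s.indicator (fun x : ℝ => Complex.exp (Complex.I * l * x)) x =
      s.indicator (fun x : ℝ => Complex.exp (Complex.I * (l - (2 * Real.pi * ξ : ℝ)) * x)) x := by
    intro s x ξ
    by_cases hx : x ∈ s
    · simp only [Set.indicator_of_mem hx]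
      rw [Circle.smul_def, Real.fourierChar_apply, smul_eq_mul, ← Complex.exp_add]
      congr 1
      push_cast
      ring
    · simp [Set.indicator_of_notMem hx]
  have hne : ∀ ξ : ℝ, l - (2 * Real.pi * ξ : ℝ) ≠ 0 := fun ξ e => hl <| by
    simpa using congrArg Complex.im e
  have hnorm : ∀ x : ℝ, ‖Complex.exp (Complex.I * l * x)‖ = Real.exp (-(l.im * x)) := by
    intro x
    rw [Complex.norm_exp]
    simp
  rcases lt_or_gt_of_ne hl with h | h
  · have hK : Integrable ((Set.Iic 0).indicator
        fun x : ℝ => Complex.exp (Complex.I * l * x)) := by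
      rw [integrable_indicator_iff measurableSet_Iic]
      exact integrableOn_exp_mul_complex_Iic (by simpa using h) 0
    convert (isBddMultiplier_fourier hK fun x => ?_).const_mul (-Complex.I) using 2 with ξ
    · rw [Real.fourier_real_eq]
      simp_rw [key]
      rw [integral_indicator measurableSet_Iic, integral_exp_mul_complex_Iic (by simpa using h)]
      have := hne ξ
      rw [← neg_sub]
      field_simp
      simp
    · by_cases hx : x ∈ Set.Iic (0 : ℝ)
      · rw [Set.indicator_of_mem hx, hnorm, Real.exp_le_one_iff]
        have : x ≤ 0 := hx
        nlinarith
      · simp [Set.indicator_of_notMem hx]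
  · have hK : Integrable ((Set.Ioi 0).indicator
        fun x : ℝ => Complex.exp (Complex.I * l * x)) := by
      rw [integrable_indicator_iff measurableSet_Ioi]
      exact integrableOn_exp_mul_complex_Ioi (by simpa using h) 0
    convert (isBddMultiplier_fourier hK fun x => ?_).const_mul Complex.I using 2 with ξ
    · rw [Real.fourier_real_eq]
      simp_rw [key]
      rw [integral_indicator measurableSet_Ioi, integral_exp_mul_complex_Ioi (by simpa using h)]
      have := hne ξ
      rw [← neg_sub]
      field_simp
      simp
    · by_cases hx : x ∈ Set.Ioi (0 : ℝ)
      · rw [Set.indicator_of_mem hx, hnorm, Real.exp_le_one_iff]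
        have : 0 < x := hx
        nlinarith
      · simp [Set.indicator_of_notMem hx]

/-- Strictly proper rational functions without real poles are bounded multipliers. -/
lemma isBddMultiplier_div {A B : ℂ[X]} (hB : ∀ x : ℝ, B.eval (x : ℂ) ≠ 0)
    (hAB : A.degree < B.degree) :
    IsBddMultiplier fun ξ => A.eval ((2 * Real.pi * ξ : ℝ) : ℂ) /
      B.eval ((2 * Real.pi * ξ : ℝ) : ℂ) := by
  induction hn : B.natDegree generalizing A B with
  | zero =>
    have hA : A = 0 := by
      rw [eq_C_of_natDegree_eq_zero hn] at hAB
      exact degree_eq_bot.1 (Nat.WithBot.lt_zero_iff.1 (hAB.trans_le degree_C_le))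
    simpa [hA] using isBddMultiplier_zero
  | succ n ih =>
    obtain ⟨l, hl⟩ := IsAlgClosed.exists_root B (by
      rw [degree_eq_natDegree (fun h => by simp [h] at hn), hn]
      exact_mod_cast n.succ_ne_zero)
    have hlim : l.im ≠ 0 := fun h => hB l.re (by
      rw [(Complex.ext rfl (by simp [h]) : ((l.re : ℝ) : ℂ) = l)]; exact hl)
    obtain ⟨B₁, rfl⟩ := dvd_iff_isRoot.2 hl
    have hB₁0 : B₁ ≠ 0 := by rintro rfl; simp at hn
    have hB₁ : B₁.natDegree = n := by
      rw [natDegree_mul (X_sub_C_ne_zero _) hB₁0, natDegree_X_sub_C] at hn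
      omega
    have hB₁e : ∀ x : ℝ, B₁.eval (x : ℂ) ≠ 0 := fun x h => hB x (by rw [eval_mul, h, mul_zero])
    -- `A/B = (X - l)⁻¹ (a + (A - a B₁)/B₁)`, where `a` cancels the coefficient of degree `n`, so
    -- that the last fraction is again strictly proper.
    set a := A.coeff n / B₁.leadingCoeff with ha
    have hAn : A.natDegree ≤ n := by
      rw [← Nat.lt_succ_iff]
      by_cases hA0 : A = 0
      · simp [hA0]
      · rw [Nat.succ_eq_add_one, ← hn]; exact natDegree_lt_natDegree hA0 hAB
    have hdeg : (A - C a * B₁).degree < B₁.degree := by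
      rw [degree_eq_natDegree hB₁0, hB₁, degree_lt_iff_coeff_zero]
      intro m hm
      rcases hm.eq_or_lt with rfl | hm
      · rw [coeff_sub, coeff_C_mul, ha]
        conv_lhs => rw [← hB₁]
        rw [coeff_natDegree, div_mul_cancel₀ _ (leadingCoeff_ne_zero.2 hB₁0), sub_self]
      · rw [coeff_sub, coeff_C_mul, coeff_eq_zero_of_natDegree_lt (hAn.trans_lt hm),
          coeff_eq_zero_of_natDegree_lt (hB₁.trans_lt hm), mul_zero, sub_zero]
    have hres := isBddMultiplier_inv_sub hlim
    convert (hres.const_mul a).add (hres.mul (ih hB₁e hdeg hB₁)) using 2 with ξ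
    have h1 := hB₁e (2 * Real.pi * ξ)
    have h2 : ((2 * Real.pi * ξ : ℝ) : ℂ) - l ≠ 0 := fun h => hB (2 * Real.pi * ξ) (by
      rw [eval_mul, eval_sub, eval_X, eval_C, h, zero_mul])
    rw [eval_mul, eval_sub, eval_sub, eval_mul, eval_X, eval_C, eval_C]
    field_simp
    ring

/-! ### Fourier uniqueness and absolutely continuous functions -/

/-- The Fourier transform is injective on `L¹`. -/
lemma ae_eq_of_fourier_eq {f g : ℝ → ℂ} (hf : Integrable f) (hg : Integrable g)
    (h : ∀ ξ, 𝓕 f ξ = 𝓕 g ξ) : f =ᵐ[volume] g := by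
  refine ae_eq_of_integral_contDiff_smul_eq hf.locallyIntegrable hg.locallyIntegrable ?_
  intro φ hφ hφc
  have hφ₁ : HasCompactSupport (Complex.ofRealCLM ∘ φ) := hφc.comp_left rfl
  have hφ₂ : ContDiff ℝ (⊤ : ℕ∞) (Complex.ofRealCLM ∘ φ) := by fun_prop
  set ψ : SchwartzMap ℝ ℂ := 𝓕⁻ (hφ₁.toSchwartzMap hφ₂) with hψ
  have hψφ : ∀ x, 𝓕 (ψ : ℝ → ℂ) x = φ x := by
    intro x
    rw [← SchwartzMap.fourier_coe, hψ, FourierTransform.fourier_fourierInv_eq]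
    simp
  -- Moving the transform from `ψ` to `u` shows that `∫ φ u` depends only on `𝓕 u`.
  have key : ∀ u : ℝ → ℂ, Integrable u → ∫ x, φ x • u x = ∫ ξ, 𝓕 u ξ * ψ ξ := by
    intro u hu
    have := VectorFourier.integral_fourierIntegral_smul_eq_flip (L := innerₗ ℝ)
      Real.continuous_fourierChar continuous_inner hu (ψ.integrable (μ := volume))
    rw [flip_innerₗ] at this
    refine Eq.trans ?_ this.symm
    refine integral_congr_ae (ae_of_all _ fun x => ?_)
    change φ x • u x = u x * 𝓕 (ψ : ℝ → ℂ) x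
    rw [hψφ, Complex.real_smul, mul_comm]
  rw [key f hf, key g hg]
  simp_rw [h]

lemma AbsolutelyContinuousOnInterval.lipschitz_comp {X Y : Type*} [PseudoMetricSpace X]
    [PseudoMetricSpace Y] {f : ℝ → X} {φ : X → Y} {a b : ℝ} (hφ : LipschitzWith 1 φ)
    (hf : AbsolutelyContinuousOnInterval f a b) :
    AbsolutelyContinuousOnInterval (φ ∘ f) a b :=
  squeeze_zero (fun _ => Finset.sum_nonneg fun _ _ => dist_nonneg)
    (fun _ => Finset.sum_le_sum fun _ _ => by simpa using hφ.dist_le_mul _ _) hf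

lemma AbsolutelyContinuousOnInterval.ae_differentiableAt_complex {f : ℝ → ℂ} {a b : ℝ}
    (hf : AbsolutelyContinuousOnInterval f a b) :
    ∀ᵐ x : ℝ, x ∈ uIcc a b → DifferentiableAt ℝ f x :=
  hf.boundedVariationOn.ae_differentiableAt_of_mem_uIcc

/-- The fundamental theorem of calculus for absolutely continuous complex functions. -/
lemma AbsolutelyContinuousOnInterval.integral_deriv_eq_sub_complex {f : ℝ → ℂ} {a b : ℝ}
    (hf : AbsolutelyContinuousOnInterval f a b) (hi : IntervalIntegrable (deriv f) volume a b) :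
    ∫ x in a..b, deriv f x = f b - f a := by
  have key : ∀ L : ℂ →L[ℝ] ℝ, LipschitzWith 1 L → L (∫ x in a..b, deriv f x) = L (f b - f a) := by
    intro L hL
    rw [← ContinuousLinearMap.intervalIntegral_comp_comm L hi, map_sub]
    refine Eq.trans ?_ (hf.lipschitz_comp hL).integral_deriv_eq_sub
    refine intervalIntegral.integral_congr_ae ?_
    filter_upwards [hf.ae_differentiableAt_complex] with x hx hxm
    exact ((L.hasFDerivAt.comp_hasDerivAt x
      (hx (uIoc_subset_uIcc hxm)).hasDerivAt).deriv).symm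
  apply Complex.ext
  · refine key Complex.reCLM (LipschitzWith.of_dist_le_mul fun x y => ?_)
    simpa [dist_eq_norm] using Complex.abs_re_le_norm (x - y)
  · refine key Complex.imCLM (LipschitzWith.of_dist_le_mul fun x y => ?_)
    simpa [dist_eq_norm] using Complex.abs_im_le_norm (x - y)

lemma ae_differentiableAt_of_absolutelyContinuous {u : ℝ → ℂ}
    (h : ∀ a b, AbsolutelyContinuousOnInterval u a b) : ∀ᵐ x : ℝ, DifferentiableAt ℝ u x := by
  have : ∀ n : ℕ, ∀ᵐ x : ℝ, x ∈ uIcc (-n : ℝ) n → DifferentiableAt ℝ u x := fun n =>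
    (h _ _).ae_differentiableAt_complex
  filter_upwards [ae_all_iff.2 this] with x hx
  obtain ⟨n, hn⟩ := exists_nat_ge |x|
  refine hx n ?_
  rw [uIcc_of_le (by linarith [abs_nonneg x])]
  exact abs_le.1 hn

/-- An integrable, locally absolutely continuous function with integrable derivative vanishes
at infinity, so that its derivative has mean zero. -/
lemma integral_deriv_eq_zero_of_absolutelyContinuous {v : ℝ → ℂ}
    (h : ∀ a b, AbsolutelyContinuousOnInterval v a b) (hv : Integrable v)
    (hv' : Integrable (deriv v)) : ∫ x, deriv v x = 0 := by
  have h1 : Tendsto (fun R : ℝ => ∫ x in (-R)..R, deriv v x) atTop (nhds (∫ x, deriv v x)) :=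
    intervalIntegral_tendsto_integral hv' tendsto_neg_atTop_atBot tendsto_id
  have h2 : (fun R : ℝ => ∫ x in (-R)..R, deriv v x) = fun R => v R - v (-R) :=
    funext fun R => (h _ _).integral_deriv_eq_sub_complex hv'.intervalIntegrable
  rw [h2] at h1
  -- An integrable function with a limit at infinity has limit zero, since neighbourhoods of
  -- infinity have infinite measure.
  have hi : Integrable fun R => v R - v (-R) := hv.sub hv.comp_neg
  refine IntegrableAtFilter.eq_zero_of_tendsto (hi.integrableAtFilter atTop) ?_ h1
  intro s hs
  obtain ⟨b, hb⟩ := mem_atTop_sets.1 hs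
  exact top_le_iff.1 ((Real.volume_Ici (a := b)).symm.le.trans (measure_mono hb))

/-- Integration by parts: the derivative of the character times `u` has mean zero. -/
lemma fourier_deriv_of_absolutelyContinuous {u : ℝ → ℂ}
    (h : ∀ a b, AbsolutelyContinuousOnInterval u a b) (hu : Integrable u)
    (hu' : Integrable (deriv u)) (ξ : ℝ) :
    𝓕 (deriv u) ξ = 2 * Real.pi * Complex.I * ξ * 𝓕 u ξ := by
  obtain ⟨c, hc⟩ : ∃ c : ℂ, c = -(2 * Real.pi * Complex.I * ξ) := ⟨_, rfl⟩
  obtain ⟨e, he⟩ : ∃ e : ℝ → ℂ, e = fun x : ℝ => Complex.exp (c * x) := ⟨_, rfl⟩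
  have hchar : ∀ x : ℝ, ((Real.fourierChar (-(x * ξ)) : Circle) : ℂ) = e x := by
    intro x
    rw [Real.fourierChar_apply, he, hc]
    push_cast
    ring_nf
  have hF : ∀ w : ℝ → ℂ, 𝓕 w ξ = ∫ x, e x * w x := by
    intro w
    rw [Real.fourier_real_eq]
    simp_rw [Circle.smul_def, hchar, smul_eq_mul]
  have hed : ∀ x, HasDerivAt e (c * e x) x := by
    intro x
    have := ((hasDerivAt_id (x : ℂ)).const_mul c).cexp.comp_ofReal
    simpa [he, mul_comm] using this
  have hen : ∀ x, ‖e x‖ ≤ 1 := fun x => by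
    rw [he, Complex.norm_exp, hc]
    simp
  have hec : Continuous e := by rw [he]; fun_prop
  have hint : ∀ w : ℝ → ℂ, Integrable w → Integrable fun x => e x * w x := fun w hw =>
    hw.bdd_mul hec.aestronglyMeasurable (ae_of_all _ hen)
  have hev : ∀ a b, AbsolutelyContinuousOnInterval (fun x => e x * u x) a b := fun a b =>
    have he1 : ContDiffOn ℝ 1 e (uIcc a b) := by
      rw [he]
      exact (contDiff_const.mul Complex.ofRealCLM.contDiff).cexp.contDiffOn
    he1.absolutelyContinuousOnInterval.fun_smul (h a b)
  have hder : deriv (fun x => e x * u x) =ᵐ[volume] fun x => e x * deriv u x + c * (e x * u x) := by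
    filter_upwards [ae_differentiableAt_of_absolutelyContinuous h] with x hx
    rw [((hed x).fun_mul hx.hasDerivAt).deriv]
    ring
  have hi₁ := hint _ hu'
  have hi₂ := (hint u hu).const_mul c
  have hi₃ : Integrable (deriv fun x => e x * u x) := (hi₁.add hi₂).congr hder.symm
  have h0 := integral_deriv_eq_zero_of_absolutelyContinuous hev (hint u hu) hi₃
  rw [integral_congr_ae hder, integral_add hi₁ hi₂, integral_const_mul, ← hF, ← hF, hc] at h0
  linear_combination h0

/-! ### Integrability of intermediate derivatives -/

/-- The `n`-th forward difference is close to a constant that is close to the `n`-th derivative. -/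
lemma norm_fwdDiff_iter_sub_le {n : ℕ} {F : ℝ → ℂ} (hF : ContDiff ℝ n F) {x ε : ℝ} {c : ℂ}
    (h : ∀ y ∈ Icc x (x + n), ‖iteratedDeriv n F y - c‖ ≤ ε) :
    ‖(fwdDiff (1 : ℝ))^[n] F x - c‖ ≤ ε := by
  induction n generalizing F with
  | zero => simpa using h x (by simp)
  | succ n ih =>
    rw [Function.iterate_succ_apply]
    have hFn : ContDiff ℝ n F := hF.of_le (by exact_mod_cast n.le_succ)
    have hsh : ContDiff ℝ n fun y => F (y + 1) := hFn.comp (contDiff_id.add contDiff_const)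
    refine ih (F := fwdDiff 1 F) (hsh.sub hFn) fun y hy => ?_
    have hd : iteratedDeriv n (fwdDiff 1 F) y =
        iteratedDeriv n F (y + 1) - iteratedDeriv n F y := by
      change iteratedDeriv n ((fun y => F (y + 1)) - F) y = _
      rw [iteratedDeriv_sub hsh.contDiffAt hFn.contDiffAt, iteratedDeriv_comp_add_const]
    have hdiff : Differentiable ℝ (iteratedDeriv n F) :=
      hF.differentiable_iteratedDeriv n (by exact_mod_cast n.lt_succ_self)
    -- Mean value inequality for `F⁽ⁿ⁾(t) - tc`, whose increment over a unit step is the quantity to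
    -- be bounded.
    have hg : ∀ t : ℝ, HasDerivAt (fun t : ℝ => iteratedDeriv n F t - t • c)
        (iteratedDeriv (n + 1) F t - c) t := by
      intro t
      rw [iteratedDeriv_succ]
      have := (hdiff t).hasDerivAt.sub ((hasDerivAt_id t).smul_const c)
      rwa [one_smul] at this
    have := norm_image_sub_le_of_norm_deriv_le_segment' (a := y) (b := y + 1) (C := ε)
      (fun t _ => (hg t).hasDerivWithinAt) (fun t ht => h t
        ⟨hy.1.trans ht.1, by push_cast; linarith [hy.2, ht.2]⟩) (y + 1) (by simp)
    rw [hd]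
    rw [add_sub_cancel_left, mul_one] at this
    refine (congrArg norm ?_).trans_le this
    module

/-- Integrability of the next lower derivative. -/
lemma integrable_iteratedDeriv_of_succ {n : ℕ} {f : ℝ → ℂ} (hf : ContDiff ℝ n f)
    (hac : ∀ a b, AbsolutelyContinuousOnInterval (iteratedDeriv n f) a b)
    (hi : Integrable f) (hi' : Integrable (iteratedDeriv (n + 1) f)) :
    Integrable (iteratedDeriv n f) := by
  -- The bound is `|f⁽ⁿ⁾(x)| ≤ |Δⁿf(x)| + ∫ φ` over `[x, x + n]`. The difference is a combination of
  -- translates of `f`, and the integral is the convolution of `φ` with the indicator of `[-n, 0]`;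
  -- both are integrable.
  set φ : ℝ → ℝ := fun t => ‖iteratedDeriv (n + 1) f t‖ with hφ
  have hφi : Integrable φ := hi'.norm
  set k : ℝ → ℝ := (Icc (-n : ℝ) 0).indicator fun _ => 1 with hk
  have hki : Integrable k := (integrable_indicator_iff measurableSet_Icc).2
    (integrableOn_const (by simp))
  have hconv := hφi.integrable_convolution (ContinuousLinearMap.mul ℝ ℝ) hki
  have hΔ : Integrable ((fwdDiff (1 : ℝ))^[n] f) := by
    have : (fwdDiff (1 : ℝ))^[n] f = fun x => ∑ j ∈ Finset.range (n + 1),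
        ((-1 : ℤ) ^ (n - j) * n.choose j) • f (x + j • (1 : ℝ)) :=
      funext fun x => fwdDiff_iter_eq_sum_shift 1 f n x
    rw [this]
    refine integrable_finsetSum _ fun j _ => ?_
    exact (hi.comp_add_right _).smul _
  refine (hΔ.norm.add hconv).mono' (hf.continuous_iteratedDeriv n le_rfl).aestronglyMeasurable
    (ae_of_all _ fun x => ?_)
  have hval : (φ ⋆[ContinuousLinearMap.mul ℝ ℝ, volume] k) x = ∫ t in Icc x (x + n), φ t := by
    rw [convolution_def, ← integral_indicator measurableSet_Icc]
    refine integral_congr_ae (ae_of_all _ fun t => ?_)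
    have : x - t ∈ Icc (-n : ℝ) 0 ↔ t ∈ Icc x (x + n) := by
      simp only [mem_Icc]
      constructor <;> rintro ⟨h1, h2⟩ <;> constructor <;> linarith
    by_cases ht : t ∈ Icc x (x + n)
    · simp [hk, indicator_of_mem ht, indicator_of_mem (this.2 ht)]
    · simp [hk, indicator_of_notMem ht, indicator_of_notMem (this.not.2 ht)]
  have hbound : ‖(fwdDiff (1 : ℝ))^[n] f x - iteratedDeriv n f x‖ ≤
      ∫ t in Icc x (x + n), φ t := by
    refine norm_fwdDiff_iter_sub_le hf fun y hy => ?_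
    have hd : deriv (iteratedDeriv n f) = iteratedDeriv (n + 1) f := iteratedDeriv_succ.symm
    rw [← (hac x y).integral_deriv_eq_sub_complex (hd ▸ hi'.intervalIntegrable), hd]
    refine (intervalIntegral.norm_integral_le_integral_norm hy.1).trans ?_
    rw [intervalIntegral.integral_of_le hy.1]
    refine setIntegral_mono_set hφi.integrableOn (ae_of_all _ fun t => norm_nonneg _) ?_
    exact (Ioc_subset_Icc_self.trans (Icc_subset_Icc_right hy.2)).eventuallyLE
  rw [Pi.add_apply, hval]
  have := norm_sub_norm_le (iteratedDeriv n f x) ((fwdDiff (1 : ℝ))^[n] f x)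
  rw [norm_sub_rev] at this
  linarith

namespace IsAdmissible

variable {r : ℕ} {f : ℝ → ℂ}

lemma contDiff_of_lt (h : IsAdmissible r f) {k : ℕ} (hk : k < r) : ContDiff ℝ k f := by
  obtain ⟨m, rfl⟩ := Nat.exists_eq_succ_of_ne_zero (Nat.ne_zero_of_lt hk)
  exact (h.contDiff m rfl).of_le (by exact_mod_cast Nat.lt_succ_iff.1 hk)

lemma absolutelyContinuous_of_lt (h : IsAdmissible r f) {k : ℕ} (hk : k < r) (a b : ℝ) :
    AbsolutelyContinuousOnInterval (iteratedDeriv k f) a b := by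
  rcases (Nat.succ_le_of_lt hk).eq_or_lt with hk' | hk'
  · exact h.absolutelyContinuous k hk'.symm a b
  · refine ContDiffOn.absolutelyContinuousOnInterval (ContDiff.contDiffOn ?_)
    refine ContDiff.iterate_deriv' 1 k ?_ |> fun h => by rwa [iteratedDeriv_eq_iterate]
    rw [add_comm]
    exact_mod_cast h.contDiff_of_lt hk'

/-- The induction descends from `r`, since each order is controlled by `f` and the next higher
derivative. -/
lemma integrable_iteratedDeriv_of_le (h : IsAdmissible r f) {k : ℕ} (hk : k ≤ r) :
    Integrable (iteratedDeriv k f) := by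
  induction hk using Nat.decreasingInduction with
  | self => exact h.integrable_iteratedDeriv
  | of_succ k hk ih =>
    exact integrable_iteratedDeriv_of_succ (h.contDiff_of_lt hk)
      (h.absolutelyContinuous_of_lt hk) h.integrable ih

lemma fourier_iteratedDeriv (h : IsAdmissible r f) {k : ℕ} (hk : k ≤ r) (ξ : ℝ) :
    𝓕 (iteratedDeriv k f) ξ = (2 * Real.pi * Complex.I * ξ) ^ k * 𝓕 f ξ := by
  induction k with
  | zero => simp
  | succ k ih =>
    have hd : deriv (iteratedDeriv k f) = iteratedDeriv (k + 1) f := iteratedDeriv_succ.symm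
    rw [← hd, fourier_deriv_of_absolutelyContinuous (h.absolutelyContinuous_of_lt hk)
      (h.integrable_iteratedDeriv_of_le (Nat.le_of_succ_le hk))
      (hd ▸ h.integrable_iteratedDeriv_of_le hk), ih (Nat.le_of_succ_le hk)]
    ring

end IsAdmissible

/-! ### The symbol of the differential operator -/

lemma diffOp_eq_sum {P : ℂ[X]} {r : ℕ} (hP : P.degree ≤ (r : WithBot ℕ)) (f : ℝ → ℂ) :
    diffOp P f = ∑ k ∈ Finset.range (r + 1),
      (P.coeff k * (-Complex.I) ^ k) • iteratedDeriv k f := by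
  ext x
  rw [diffOp, sum_over_range' _ (by simp) (r + 1)
    (Nat.lt_succ_of_le (natDegree_le_of_degree_le hP))]
  simp [Finset.sum_apply]

lemma diffOp_C_mul_add (c : ℂ) (P Q : ℂ[X]) (f : ℝ → ℂ) :
    diffOp (C c * P + Q) f = c • diffOp P f + diffOp Q f := by
  ext x
  rw [Pi.add_apply, Pi.smul_apply, diffOp, sum_add_index _ _ _ (by simp) (by intros; ring),
    ← smul_eq_C_mul, sum_smul_index _ _ _ (by simp), diffOp, diffOp, smul_eq_mul]
  congr 1
  rw [Polynomial.sum, Polynomial.sum, Finset.mul_sum]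
  simp_rw [mul_assoc]

lemma fourier_finset_sum_smul {ι : Type*} (s : Finset ι) (a : ι → ℂ) {g : ι → ℝ → ℂ}
    (hg : ∀ i ∈ s, Integrable (g i)) (ξ : ℝ) :
    𝓕 (∑ i ∈ s, a i • g i) ξ = ∑ i ∈ s, a i * 𝓕 (g i) ξ := by
  classical
  induction s using Finset.induction_on with
  | empty => simpa using fourier_const_smul_apply 0 0 ξ
  | insert i s hi ih =>
    have h1 := fun j hj => hg j (Finset.mem_insert_of_mem hj)
    rw [Finset.sum_insert hi, Finset.sum_insert hi,
      fourier_add_apply ((hg i (Finset.mem_insert_self _ _)).smul _)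
        (integrable_finsetSum' _ fun j hj => (h1 j hj).smul _), fourier_const_smul_apply, ih h1]

namespace IsAdmissible

variable {r : ℕ} {f : ℝ → ℂ} {P : ℂ[X]}

lemma integrable_diffOp (h : IsAdmissible r f) (hP : P.degree ≤ (r : WithBot ℕ)) :
    Integrable (diffOp P f) := by
  rw [diffOp_eq_sum hP]
  exact integrable_finsetSum' _ fun k hk =>
    (h.integrable_iteratedDeriv_of_le (Finset.mem_range_succ_iff.1 hk)).smul _

lemma fourier_diffOp (h : IsAdmissible r f) (hP : P.degree ≤ (r : WithBot ℕ)) (ξ : ℝ) :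
    𝓕 (diffOp P f) ξ = P.eval ((2 * Real.pi * ξ : ℝ) : ℂ) * 𝓕 f ξ := by
  rw [diffOp_eq_sum hP, fourier_finset_sum_smul _ _ fun k hk =>
    h.integrable_iteratedDeriv_of_le (Finset.mem_range_succ_iff.1 hk),
    eval_eq_sum_range' (Nat.lt_succ_of_le (natDegree_le_of_degree_le hP)), Finset.sum_mul]
  refine Finset.sum_congr rfl fun k hk => ?_
  rw [h.fourier_iteratedDeriv (Finset.mem_range_succ_iff.1 hk)]
  have : ((2 * Real.pi * ξ : ℝ) : ℂ) = -Complex.I * (2 * Real.pi * Complex.I * ξ) := by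
    push_cast
    linear_combination (2 * Real.pi * ξ : ℂ) * Complex.I_mul_I
  rw [this, mul_pow (-Complex.I)]
  simp only [mul_assoc]

end IsAdmissible

/-! ### The inequalities -/

/-- The inequality for an operator of order strictly below `r`. -/
lemma exists_eLpNorm_diffOp_le_of_degree_lt {r : ℕ} {Q P₁ P₂ : ℂ[X]}
    (hQ : Q.degree < (r : WithBot ℕ)) (hP₁ : P₁.degree = (r : WithBot ℕ))
    (hP₂ : P₂.degree ≤ (r : WithBot ℕ)) (hzeros : CommonRealZerosAreZeros P₁ P₂ Q)
    {q p₁ p₂ : ℝ≥0∞} (h₁ : 1 ≤ p₁) (h₁q : p₁ ≤ q) (h₂ : 1 ≤ p₂) (h₂q : p₂ ≤ q) :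
    ∃ c : ℝ≥0, ∀ f : ℝ → ℂ, IsAdmissible r f →
      eLpNorm (diffOp Q f) q volume ≤
        c * (eLpNorm (diffOp P₁ f) p₁ volume + eLpNorm (diffOp P₂ f) p₂ volume) := by
  have hP₁0 : P₁ ≠ 0 := by rintro rfl; simp at hP₁
  obtain ⟨R, A₁, A₂, hR, hA₁, hA₂, hbez⟩ :=
    hzeros.exists_bezout hP₁0 (hP₁ ▸ hP₂) (hP₁ ▸ hQ)
  obtain ⟨C₁, hC₁⟩ := isBddMultiplier_div hR hA₁ p₁ q h₁ h₁q
  obtain ⟨C₂, hC₂⟩ := isBddMultiplier_div hR hA₂ p₂ q h₂ h₂q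
  refine ⟨max C₁ C₂, fun f hf => ?_⟩
  obtain ⟨u, hu, hu', hu''⟩ := hC₁ _ (hf.integrable_diffOp hP₁.le)
  obtain ⟨v, hv, hv', hv''⟩ := hC₂ _ (hf.integrable_diffOp hP₂)
  -- Both sides are integrable and have the same transform, by the Bézout identity at `2πξ` divided
  -- by `R`.
  have hae : diffOp Q f =ᵐ[volume] u + v := by
    refine ae_eq_of_fourier_eq (hf.integrable_diffOp hQ.le) (hu.add hv) fun ξ => ?_
    rw [fourier_add_apply hu hv, hu', hv', hf.fourier_diffOp hQ.le, hf.fourier_diffOp hP₁.le,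
      hf.fourier_diffOp hP₂]
    have hb := congrArg (eval ((2 * Real.pi * ξ : ℝ) : ℂ)) hbez
    rw [eval_add, eval_mul, eval_mul, eval_mul] at hb
    have hR0 := hR (2 * Real.pi * ξ)
    rw [eq_div_of_mul_eq hR0 hb]
    ring
  rw [eLpNorm_congr_ae hae, mul_add]
  refine (eLpNorm_add_le hu.1 hv.1 (h₁.trans h₁q)).trans (add_le_add (hu''.trans ?_) (hv''.trans ?_))
  · gcongr
    exact le_max_left _ _
  · gcongr
    exact le_max_right _ _

theorem mainTheorem4 (r : ℕ) (Q P₁ P₂ : ℂ[X]) (hQ : Q.degree ≤ (r : WithBot ℕ))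
    (hP₁ : P₁.degree = (r : WithBot ℕ)) (hP₂ : P₂.degree ≤ (r : WithBot ℕ))
    (hzeros : CommonRealZerosAreZeros P₁ P₂ Q)
    (q : ℝ≥0∞) (hq : 1 ≤ q) :
    (Q.degree = (r : WithBot ℕ) →
      ∀ p₂ : ℝ≥0∞, 1 ≤ p₂ → p₂ ≤ q →
        ∃ c : ℝ≥0, ∀ f : ℝ → ℂ, IsAdmissible r f →
          eLpNorm (diffOp Q f) q volume ≤
            c * (eLpNorm (diffOp P₁ f) q volume + eLpNorm (diffOp P₂ f) p₂ volume)) ∧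
    (Q.degree < (r : WithBot ℕ) →
      ∀ p₁ p₂ : ℝ≥0∞, 1 ≤ p₁ → p₁ ≤ q → 1 ≤ p₂ → p₂ ≤ q →
        ∃ c : ℝ≥0, ∀ f : ℝ → ℂ, IsAdmissible r f →
          eLpNorm (diffOp Q f) q volume ≤
            c * (eLpNorm (diffOp P₁ f) p₁ volume + eLpNorm (diffOp P₂ f) p₂ volume)) := by
  refine ⟨fun hQr p₂ h₂ h₂q => ?_, fun hQr p₁ p₂ h₁ h₁q h₂ h₂q =>
    exists_eLpNorm_diffOp_le_of_degree_lt hQr hP₁ hP₂ hzeros h₁ h₁q h₂ h₂q⟩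
  have hP₁0 : P₁ ≠ 0 := by rintro rfl; simp at hP₁
  have hQ0 : Q ≠ 0 := by rintro rfl; simp at hQr
  -- This multiple of `P₁` removes the leading term of `Q`. Subtracting it preserves divisibility by
  -- the common factors of `P₁` and `P₂`.
  set a := Q.leadingCoeff / P₁.leadingCoeff with ha
  have ha0 : a ≠ 0 := div_ne_zero (leadingCoeff_ne_zero.2 hQ0) (leadingCoeff_ne_zero.2 hP₁0)
  set Q' := Q - C a * P₁ with hQ'
  have hQ'r : Q'.degree < (r : WithBot ℕ) := by
    rw [← hQr]
    refine degree_sub_lt_left ?_ hQ0 ?_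
    · rw [degree_C_mul ha0, hP₁, hQr]
    · rw [leadingCoeff_mul, leadingCoeff_C, ha, div_mul_cancel₀ _ (leadingCoeff_ne_zero.2 hP₁0)]
  have hz : CommonRealZerosAreZeros P₁ P₂ Q' := fun x n h₁ h₂ =>
    dvd_sub (hzeros x n h₁ h₂) (h₁.mul_left _)
  obtain ⟨c, hc⟩ := exists_eLpNorm_diffOp_le_of_degree_lt hQ'r hP₁ hP₂ hz hq le_rfl h₂ h₂q
  refine ⟨‖a‖₊ + c, fun f hf => ?_⟩
  have hQe : Q = C a * P₁ + Q' := by rw [hQ']; ring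
  conv_lhs => rw [hQe, diffOp_C_mul_add]
  refine (eLpNorm_add_le ((hf.integrable_diffOp hP₁.le).1.const_smul a)
    (hf.integrable_diffOp hQ'r.le).1 hq).trans ?_
  rw [eLpNorm_const_smul, ENNReal.coe_add, add_mul]
  refine add_le_add ?_ (hc f hf)
  exact mul_le_mul_right (le_add_right le_rfl) _
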